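/- Let $\delta > 0$. There is a number $\sigma_0 = \sigma_0(\delta) > 0$, depending only on $\delta$, with the following property. Let $X$ be a metric space which is a length space (the distance between any two points is the infimum of the lengths of the paths joining them) and which is $\delta$-hyperbolic, i.e. for all $x,y,z,t \in X$, $$\langle x,z\rangle_t \ge \min\{\langle x,y\rangle_t, \langle y,z\rangle_t\} - \delta, \qquad \text{where } \langle x,y\rangle_t = \tfrac12\bigl(|x-t| + |y-t| - |x-y|\bigr).$$ Let $G$ be a group acting by isometries on $X$, let $\sigma \ge \sigma_0$, and let $\mathcal R$ be a non-empty $\sigma$-rotation family, i.e. a non-empty collection of pairs $(H,v)$, where $H$ is a subgroup of $G$ (called a rotation group) and $v$ is a point of $X$, such that 1. for every $(H,v)\in\mathcal R$, $H$ is contained in the stabilizer of $v$, and $|hx-x| = 2|v-x|$ for every $x \in X$ with $|v-x| \le \sigma/10$ and every $h \in H\setminus\{1\}$; 2. $|v-v'| \ge \sigma$ for any two distinct pairs $(H,v),(H',v')\in\mathcal R$; 3. $(gHg^{-1}, gv) \in \mathcal R$ for every $g\in G$ and every $(H,v)\in\mathcal R$. Let $K$ be the subgroup of $G$ generated by all the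 rotation groups $H$, $(H,v)\in\mathcal R$. Then $K$ is normal in $G$, and for every $g \in K$ that belongs to none of the rotation groups and every $x \in X$, $$|gx - x| \ge \sigma - 166\,\delta .$$ -/

import Mathlib

universe u v

/-- `X` is a length space: the distance between two points is the infimum of the lengths of the
continuous paths joining them. The length of a path is its total variation; it is `⊤` for a path
that is not rectifiable, and the infimum is `⊤` when there is no path. -/
def IsLengthSpace (X : Type*) [MetricSpace X] : Prop :=
  ∀ x y : X, edist x y = ⨅ γ : Path x y, eVariationOn (γ : unitInterval → X) Set.univ

/-- The Gromov product `⟨x, y⟩_z` of `x` and `y` with respect to the base point `z`. -/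
noncomputable def gromovProduct {X : Type*} [MetricSpace X] (x y z : X) : ℝ :=
  (1 / 2) * (dist x z + dist y z - dist x y)

/-- `X` is `δ`-hyperbolic in the sense of the four points inequality. -/
def IsGromovHyperbolic (δ : ℝ) (X : Type*) [MetricSpace X] : Prop :=
  ∀ x y z t : X,
    min (gromovProduct x y t) (gromovProduct y z t) - δ ≤ gromovProduct x z t

/-- A `σ`-rotation family (for `σ > 0`) for the action of `G` on `X`: a collection of pairs
`(H, v)`, where the subgroup `H` is called a rotation group and the point `v` its apex. -/
structure IsRotationFamily {G X : Type*} [Group G] [MetricSpace X] [MulAction G X]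
    (σ : ℝ) (R : Set (Subgroup G × X)) : Prop where
  /-- Every rotation group fixes its apex. -/
  le_stabilizer : ∀ H : Subgroup G, ∀ v : X, (H, v) ∈ R → H ≤ MulAction.stabilizer G v
  /-- Non-trivial elements of a rotation group are rotations of very large angle near the apex. -/
  large_angle : ∀ H : Subgroup G, ∀ v : X, (H, v) ∈ R →
    ∀ x ∈ Metric.closedBall v (σ / 10), ∀ h ∈ H, h ≠ 1 → dist (h • x) x = 2 * dist v x
  /-- Distinct pairs have apices far apart. -/
  apices_apart : ∀ H H' : Subgroup G, ∀ v v' : X, (H, v) ∈ R → (H', v') ∈ R →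
    (H, v) ≠ (H', v') → σ ≤ dist v v'
  /-- The collection is stable under `g • (H, v) = (g H g⁻¹, g v)`. -/
  smul_mem : ∀ g : G, ∀ H : Subgroup G, ∀ v : X, (H, v) ∈ R →
    (H.map (MulAut.conj g).toMonoidHom, g • v) ∈ R

/-- The set of rotation groups of a collection of pairs `(H, v)`. -/
def rotationGroups {G X : Type*} [Group G] (R : Set (Subgroup G × X)) : Set (Subgroup G) :=
  {H | ∃ v : X, (H, v) ∈ R}

/-- The subgroup generated by all rotation groups. -/
def rotationSubgroup {G X : Type*} [Group G] (R : Set (Subgroup G × X)) : Subgroup G :=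
  Subgroup.closure {g | ∃ H ∈ rotationGroups R, g ∈ H}

/-! This is a windmill argument. A nontrivial rotation at an apex `v` takes two points with product
at least `4δ` at `v` to a pair with product at most `2δ` when applied to one of them
(`IsRotationSystem.gromovProduct_smul_le`). A path through apices bent by such rotations is then a
local geodesic with steps at least `σ`, hence almost a global one: each step gains at least `σ - 6 *
δ`.

A windmill is a set `A` of apices whose rotations generate a group in which the displacement bound
already holds. If apices remain, those nearly closest to the hull of `A` form a fan with it
(`IsWindmill.exists_isFan`). An element of the enlarged group is a reduced word in the new rotations
times an element of the old group. After cyclic reduction it is in the old group, or is a rotation,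
or its powers are given by reduced words of proportional length, so that it moves every point by at
least `σ - 6 * δ` (`IsFan.rotationOrFar_word`). The translates of the fan stay quasi-convex among
the apices (`IsFan.far_word`), so they form a strictly larger windmill. By Zorn's lemma a maximal
windmill exists, and it contains every apex. -/

set_option linter.unusedSectionVars false

/-! ### Gromov products and discrete paths in hyperbolic spaces -/

section Gromov

variable {X : Type*} [MetricSpace X] {δ : ℝ}

theorem gromovProduct_comm (x y z : X) : gromovProduct x y z = gromovProduct y x z := by
  simp only [gromovProduct, dist_comm x y]; ring

theorem gromovProduct_nonneg (x y z : X) : 0 ≤ gromovProduct x y z := by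
  have := dist_triangle_right x y z
  simp only [gromovProduct]; linarith

theorem gromovProduct_le_dist (x y z : X) : gromovProduct x y z ≤ dist x z := by
  have := dist_triangle y x z
  rw [dist_comm y x] at this
  simp only [gromovProduct]; linarith

theorem gromovProduct_self (x z : X) : gromovProduct x x z = dist x z := by
  simp only [gromovProduct, dist_self]; ring

theorem gromovProduct_base (x y : X) : gromovProduct x y x = 0 := by
  simp only [gromovProduct, dist_self, dist_comm x y]; ring

theorem gromovProduct_swap (x y z : X) :
    gromovProduct x y z = dist y z - gromovProduct x z y := by
  simp only [gromovProduct, dist_comm z y]; ring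

theorem dist_eq_gromovProduct (x y z : X) :
    dist x y = dist x z + dist z y - 2 * gromovProduct x y z := by
  simp only [gromovProduct, dist_comm z y]; ring

theorem gromovProduct_smul {G : Type*} [Group G] [MulAction G X] [IsIsometricSMul G X]
    (g : G) (x y z : X) : gromovProduct (g • x) (g • y) (g • z) = gromovProduct x y z := by
  simp only [gromovProduct, dist_smul]

theorem gromovProduct_smul_base {G : Type*} [Group G] [MulAction G X] [IsIsometricSMul G X]
    (g : G) (x y z : X) : gromovProduct (g • x) (g • y) z = gromovProduct x y (g⁻¹ • z) := by
  rw [← gromovProduct_smul g x y (g⁻¹ • z), smul_inv_smul]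

theorem IsGromovHyperbolic.le_or_le (hX : IsGromovHyperbolic δ X) (x y z t : X) :
    gromovProduct x y t ≤ gromovProduct x z t + δ ∨
      gromovProduct y z t ≤ gromovProduct x z t + δ := by
  have := hX x y z t
  rcases min_choice (gromovProduct x y t) (gromovProduct y z t) with h | h <;> rw [h] at this
  · left; linarith
  · right; linarith

/-- In a length space there are points at any prescribed distance on almost geodesic paths. -/
theorem IsLengthSpace.exists_point (hX : IsLengthSpace X) {v y : X} {t ε : ℝ} (ht : 0 ≤ t)
    (hty : t ≤ dist v y) (hε : 0 < ε) :
    ∃ m : X, dist v m = t ∧ t - ε ≤ gromovProduct y m v := by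
  have hlt : (⨅ γ : Path v y, eVariationOn (γ : unitInterval → X) Set.univ) <
      edist v y + ENNReal.ofReal ε := by
    rw [← hX v y]
    exact ENNReal.lt_add_right (edist_ne_top v y) (by simpa using hε)
  obtain ⟨γ, hγ⟩ := iInf_lt_iff.1 hlt
  obtain ⟨s, -, hs⟩ : t ∈ (fun s : unitInterval => dist v (γ s)) '' Set.Icc 0 1 := by
    apply intermediate_value_Icc zero_le_one (by fun_prop)
    simpa using ⟨ht, hty⟩
  refine ⟨γ s, hs, ?_⟩
  have h1 : edist v (γ s) + edist (γ s) y ≤ eVariationOn (γ : unitInterval → X) Set.univ := by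
    have h0 := eVariationOn.edist_le γ (s := Set.univ ∩ Set.Icc 0 s) (x := 0) (y := s)
      (by simp) (by simp)
    have h0' := eVariationOn.edist_le γ (s := Set.univ ∩ Set.Icc s 1) (x := s) (y := 1)
      (by simp [unitInterval.le_one']) (by simp [unitInterval.le_one'])
    rw [γ.source] at h0
    rw [γ.target] at h0'
    refine (add_le_add h0 h0').trans ?_
    rw [eVariationOn.Icc_add_Icc γ unitInterval.nonneg' unitInterval.le_one' (Set.mem_univ s)]
    exact eVariationOn.mono γ Set.inter_subset_left
  have h2 := h1.trans hγ.le
  rw [edist_dist, edist_dist, edist_dist, ← ENNReal.ofReal_add, ← ENNReal.ofReal_add,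
    ENNReal.ofReal_le_ofReal_iff] at h2
  · simp only [gromovProduct]
    simp only at hs
    rw [dist_comm y v, dist_comm (γ s) v, dist_comm y]
    linarith
  all_goals positivity

/-- If `p` and `q` are close to the hull of a set, then so is every point close to `[p, q]` and far
from `p` and `q`. -/
theorem IsGromovHyperbolic.exists_gromovProduct_le (hX : IsGromovHyperbolic δ X) (hδ : 0 < δ)
    {A : Set X} {M t σ : ℝ} {a b c d p q u : X} (ha : a ∈ A) (hb : b ∈ A) (hc : c ∈ A) (hd : d ∈ A)
    (hp : gromovProduct a b p ≤ M) (hq : gromovProduct c d q ≤ M) (hpu : σ ≤ dist p u)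
    (hqu : σ ≤ dist q u) (hpq : gromovProduct p q u ≤ t) :
    ∃ e ∈ A, ∃ f ∈ A,
      gromovProduct e f u ≤ t + 3 * δ ∨ gromovProduct e f u ≤ M - σ + 2 * t + 5 * δ := by
  have key : ∀ {a b p : X}, a ∈ A → b ∈ A → gromovProduct a b p ≤ M → σ ≤ dist p u →
      gromovProduct p a u ≤ t + 2 * δ → ∃ e ∈ A, ∃ f ∈ A,
      gromovProduct e f u ≤ t + 3 * δ ∨ gromovProduct e f u ≤ M - σ + 2 * t + 5 * δ := by
    intro a b p ha hb hp hpu h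
    refine ⟨a, ha, b, hb, ?_⟩
    -- If `⟨p,b⟩_u ≤ t + 3δ`, the identity `⟨a,b⟩_u = ⟨a,p⟩_u + ⟨p,b⟩_u - |p-u| + ⟨a,b⟩_p` gives the
    -- second bound.
    rcases hX.le_or_le p b a u with h1 | h1
    · right
      simp only [gromovProduct, dist_comm p] at *
      linarith
    · left
      rw [gromovProduct_comm]
      linarith
  by_cases h1 : gromovProduct p a u ≤ t + 2 * δ
  · exact key ha hb hp hpu h1
  by_cases h2 : gromovProduct q c u ≤ t + 2 * δ
  · exact key hc hd hq hqu h2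
  refine ⟨a, ha, c, hc, Or.inl ?_⟩
  push Not at h1 h2
  rcases hX.le_or_le p a q u with h | h
  · linarith
  · rcases hX.le_or_le a c q u with h' | h'
    · linarith
    · rw [gromovProduct_comm] at h'; linarith

/-- A sequence of points with long steps and small Gromov products at its interior points. -/
structure IsLocalGeodesic (δ σ : ℝ) (p : ℕ → X) (n : ℕ) : Prop where
  le_dist : ∀ i < n, σ ≤ dist (p i) (p (i + 1))
  angle : ∀ i, i + 1 < n → gromovProduct (p i) (p (i + 2)) (p (i + 1)) ≤ 2 * δ

/-! ### From local to global geodesics -/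

namespace IsLocalGeodesic

variable {σ : ℝ} {p : ℕ → X} {n : ℕ}

/-- The product of `p 0` and `p i` at `p (i + 1)` is the step length minus the product at `p i`, so
at least `σ - 3δ`. Being large, it cannot be the minimum in the four points inequality, and the
angle bound `2δ` passes to `p 0` at the cost of one `δ`. -/
theorem gromovProduct_zero_succ (hX : IsGromovHyperbolic δ X) (hδ : 0 < δ) (hσ : 100 * δ ≤ σ)
    (hp : IsLocalGeodesic δ σ p n) :
    ∀ i < n, gromovProduct (p 0) (p (i + 1)) (p i) ≤ 3 * δ := by
  intro i
  induction i with
  | zero => intro _; rw [gromovProduct_base]; positivity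
  | succ i ih =>
    intro hi
    have h1 := ih (by omega)
    have h2 := hp.angle i hi
    have h3 := hp.le_dist i (by omega)
    have h4 := gromovProduct_swap (p 0) (p i) (p (i + 1))
    rcases hX.le_or_le (p i) (p 0) (p (i + 2)) (p (i + 1)) with h | h
    · rw [gromovProduct_comm] at h; linarith
    · linarith

theorem gromovProduct_last (hX : IsGromovHyperbolic δ X) (hδ : 0 < δ) (hσ : 100 * δ ≤ σ)
    (hp : IsLocalGeodesic δ σ p n) (k : ℕ) :
    ∀ i, i + 1 + k = n → gromovProduct (p i) (p n) (p (i + 1)) ≤ 3 * δ := by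
  induction k with
  | zero =>
    rintro i rfl
    rw [gromovProduct_comm, add_zero, gromovProduct_base]; positivity
  | succ k ih =>
    intro i hi
    have h1 := ih (i + 1) (by omega)
    have h2 := hp.angle i (by omega)
    have h3 := hp.le_dist (i + 1) (by omega)
    have h4 := gromovProduct_swap (p n) (p (i + 1 + 1)) (p (i + 1))
    rw [gromovProduct_comm _ (p (i + 1)), dist_comm] at h4
    rcases hX.le_or_le (p i) (p n) (p (i + 2)) (p (i + 1)) with h | h
    · linarith
    · linarith

theorem gromovProduct_zero_last (hX : IsGromovHyperbolic δ X) (hδ : 0 < δ) (hσ : 100 * δ ≤ σ)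
    (hp : IsLocalGeodesic δ σ p n) {i : ℕ} (hi : i < n) :
    gromovProduct (p 0) (p n) (p i) ≤ 4 * δ := by
  have h1 := hp.gromovProduct_zero_succ hX hδ hσ i hi
  have h2 := hp.gromovProduct_last hX hδ hσ (n - (i + 1)) i (by omega)
  have h3 := hp.le_dist i hi
  have h4 := gromovProduct_swap (p n) (p (i + 1)) (p i)
  rw [gromovProduct_comm _ (p i), dist_comm] at h4
  rcases hX.le_or_le (p 0) (p n) (p (i + 1)) (p i) with h | h
  · linarith
  · linarith

theorem le_dist_zero (hX : IsGromovHyperbolic δ X) (hδ : 0 < δ) (hσ : 100 * δ ≤ σ)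
    (hp : IsLocalGeodesic δ σ p n) : ∀ i ≤ n, i * (σ - 6 * δ) ≤ dist (p 0) (p i) := by
  intro i
  induction i with
  | zero => simp
  | succ i ih =>
    intro hi
    have h1 := ih (by omega)
    have h2 := hp.gromovProduct_zero_succ hX hδ hσ i hi
    have h3 := hp.le_dist i hi
    rw [dist_eq_gromovProduct _ _ (p i)]
    push_cast
    linarith

/-- A point close to the endpoints' geodesic but far from the vertices is close to one of the
sides. -/
theorem exists_gromovProduct_le (hX : IsGromovHyperbolic δ X) (hδ : 0 < δ) (hσ : 100 * δ ≤ σ)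
    (hp : IsLocalGeodesic δ σ p n) (hn : 0 < n) {u : X} {t : ℝ}
    (hu : ∀ i < n, 2 * t + 7 * δ < dist u (p i)) (ht : gromovProduct (p 0) (p n) u ≤ t) :
    ∃ i < n, gromovProduct (p i) (p (i + 1)) u ≤ t + 2 * δ := by
  classical
  have hex : ∃ i, 0 < i ∧ i ≤ n ∧ gromovProduct (p 0) (p i) u ≤ t + δ :=
    ⟨n, hn, le_rfl, by linarith⟩
  obtain ⟨h0, hin, hi⟩ := Nat.find_spec hex
  have hmin := fun m => Nat.find_min hex (m := m)
  generalize Nat.find hex = i at *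
  obtain ⟨j, rfl⟩ : ∃ j, i = j + 1 := ⟨i - 1, by omega⟩
  refine ⟨j, hin, ?_⟩
  rcases Nat.eq_zero_or_pos j with rfl | hj
  · linarith
  have h1 : ¬ gromovProduct (p 0) (p j) u ≤ t + δ := fun h =>
    hmin j (by omega) ⟨hj, by omega, h⟩
  rcases hX.le_or_le (p 0) (p j) (p (j + 1)) u with h2 | h2
  · rcases hX.le_or_le (p 0) (p j) (p n) u with h3 | h3
    · exact absurd (by linarith) h1
    -- Here `⟨p 0, p j⟩_u ≤ t + 2δ` and `⟨p j, p n⟩_u ≤ t + δ`. Their sum is `|u - p j|` up to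
    -- products of `p 0` and `p n`, the one at `p j` being at most `4δ`; so `|u - p j| ≤ 2t + 7δ`,
    -- against `hu`.
    · have h4 := hp.gromovProduct_zero_last hX hδ hσ (i := j) (by omega)
      have h5 := hu j (by omega)
      have h6 := gromovProduct_nonneg (p 0) (p n) u
      simp only [gromovProduct, dist_comm u, dist_comm (p j) (p n)] at *
      linarith
  · linarith

end IsLocalGeodesic

end Gromov

/-! ### Rotations, windmills, fans and reduced words -/

section RotationSystem

variable {G X : Type*} [Group G] [MetricSpace X] [MulAction G X] {δ σ : ℝ} {C : Set X}
  {Γ : X → Subgroup G}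

/-- A rotation family described by its set `C` of apices and the rotation group `Γ v` of each
apex `v`. -/
structure IsRotationSystem (σ : ℝ) (C : Set X) (Γ : X → Subgroup G) : Prop where
  smul_apex : ∀ v ∈ C, ∀ h ∈ Γ v, h • v = v
  large_angle : ∀ v ∈ C, ∀ x, dist v x ≤ σ / 10 → ∀ h ∈ Γ v, h ≠ 1 →
    dist (h • x) x = 2 * dist v x
  apart : ∀ v ∈ C, ∀ w ∈ C, v ≠ w → σ ≤ dist v w
  smul_mem : ∀ (g : G), ∀ v ∈ C, g • v ∈ C
  conj_mem : ∀ (g : G), ∀ v ∈ C, ∀ h ∈ Γ v, g * h * g⁻¹ ∈ Γ (g • v)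

/-- A non-trivial rotation of apex `v` opens up the small angles at `v`. -/
theorem IsRotationSystem.gromovProduct_smul_le [IsIsometricSMul G X]
    (hC : IsRotationSystem σ C Γ) (hL : IsLengthSpace X)
    (hX : IsGromovHyperbolic δ X) (hδ : 0 < δ) (hσ : 100 * δ ≤ σ) {v y z : X} {h : G} (hv : v ∈ C)
    (hh : h ∈ Γ v) (h1 : h ≠ 1) (hyz : 4 * δ ≤ gromovProduct y z v) :
    gromovProduct y (h • z) v ≤ 2 * δ := by
  have hzv : 4 * δ ≤ dist v z := by
    rw [gromovProduct_comm] at hyz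
    rw [dist_comm]
    exact hyz.trans (gromovProduct_le_dist z y v)
  -- The large angle is known only within `σ / 10` of `v`, so `z` is replaced by a point `m` at
  -- distance `4δ ≤ σ / 10` in its direction. The products of `m` with `y` and of `h • m` with `h •
  -- z` are large, while that of `m` with `h • m` vanishes.
  obtain ⟨m, hm, hzm⟩ := hL.exists_point (by positivity) hzv (half_pos hδ)
  have hrot := hC.large_angle v hv m (by linarith) h hh h1
  have hfix := hC.smul_apex v hv h hh
  have hmm : gromovProduct m (h • m) v = 0 := by
    have : dist v (h • m) = dist v m := by
      conv_lhs => rw [← hfix]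
      exact dist_smul h v m
    simp only [gromovProduct, dist_comm m, hrot, dist_comm _ v, this]
    ring
  have hhm : gromovProduct (h • z) (h • m) v = gromovProduct z m v := by
    conv_lhs => rw [← hfix]
    exact gromovProduct_smul h z m v
  have hym : 3 * δ - δ / 2 ≤ gromovProduct y m v := by
    rcases hX.le_or_le y z m v with h | h <;> linarith
  rcases hX.le_or_le m y (h • m) v with h2 | h2
  · rw [gromovProduct_comm] at h2
    linarith
  · rcases hX.le_or_le y (h • z) (h • m) v with h3 | h3 <;> linarith

/-- The subgroup generated by the rotation groups with apices in `A`. -/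
def rotationsOver (Γ : X → Subgroup G) (A : Set X) : Subgroup G :=
  Subgroup.closure {g | ∃ v ∈ A, g ∈ Γ v}

theorem mem_rotationsOver {A : Set X} {v : X} {g : G} (hv : v ∈ A) (hg : g ∈ Γ v) :
    g ∈ rotationsOver Γ A :=
  Subgroup.subset_closure ⟨v, hv, hg⟩

theorem rotationsOver_mono {A B : Set X} (h : A ⊆ B) : rotationsOver Γ A ≤ rotationsOver Γ B :=
  Subgroup.closure_mono fun _ ⟨v, hv, hg⟩ => ⟨v, h hv, hg⟩

/-- `g` is a rotation, or it moves every point by a large amount. -/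
def IsRotationOrFar (δ σ : ℝ) (C : Set X) (Γ : X → Subgroup G) (g : G) : Prop :=
  (∃ v ∈ C, g ∈ Γ v) ∨ ∀ x : X, σ - 6 * δ ≤ dist (g • x) x

theorem IsRotationOrFar.conj [IsIsometricSMul G X] (hC : IsRotationSystem σ C Γ) {g : G}
    (hg : IsRotationOrFar δ σ C Γ g) (f : G) : IsRotationOrFar δ σ C Γ (f * g * f⁻¹) := by
  rcases hg with ⟨v, hv, hg⟩ | hg
  · exact Or.inl ⟨f • v, hC.smul_mem f v hv, hC.conj_mem f v hv g hg⟩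
  · refine Or.inr fun x => ?_
    have := hg (f⁻¹ • x)
    rwa [← dist_smul f, smul_inv_smul, ← mul_smul, ← mul_smul] at this

/-- A set of apices stable under its own rotations, quasi-convex among the apices, and whose
rotations generate a group in which the non-rotations move every point by a large amount. -/
structure IsWindmill (δ σ : ℝ) (C : Set X) (Γ : X → Subgroup G) (A : Set X) : Prop where
  subset : A ⊆ C
  nonempty : A.Nonempty
  smul_mem : ∀ g ∈ rotationsOver Γ A, ∀ a ∈ A, g • a ∈ A
  far : ∀ v ∈ C, v ∉ A → ∀ a ∈ A, ∀ b ∈ A, 8 * δ ≤ gromovProduct a b v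
  rotationOrFar : ∀ g ∈ rotationsOver Γ A, IsRotationOrFar δ σ C Γ g

/-- A windmill `A` and a set `V` of further apices that see each other and `A` under a small
angle. -/
structure IsFan (δ σ : ℝ) (C : Set X) (Γ : X → Subgroup G) (A V : Set X) : Prop where
  windmill : IsWindmill δ σ C Γ A
  subset : V ⊆ C
  notMem : ∀ v ∈ V, v ∉ A
  smul_mem : ∀ g ∈ rotationsOver Γ A, ∀ v ∈ V, g • v ∈ V
  angle : ∀ v ∈ V, ∀ p ∈ A ∪ V, ∀ q ∈ A ∪ V, p ≠ v → q ≠ v → 4 * δ ≤ gromovProduct p q v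
  far : ∀ u ∈ C, u ∉ A ∪ V → ∀ p ∈ A ∪ V, ∀ q ∈ A ∪ V, 10 * δ < gromovProduct p q u

/-- Words in non-trivial rotations with apices in `V` and distinct consecutive apices. -/
structure IsReducedWord (Γ : X → Subgroup G) (V : Set X) (l : List (X × G)) : Prop where
  mem : ∀ e ∈ l, e.1 ∈ V ∧ e.2 ∈ Γ e.1 ∧ e.2 ≠ 1
  isChain : l.IsChain fun e f => e.1 ≠ f.1

/-- The product of the rotations in a word. -/
def wordProd (l : List (X × G)) : G := (l.map Prod.snd).prod

/-- Translation of a word by a group element. -/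
def smulWord (g : G) (l : List (X × G)) : List (X × G) :=
  l.map fun e => (g • e.1, g * e.2 * g⁻¹)

/-- The path from `a` to `wordProd l • b` through the successive centers of rotation. -/
def wordPath (a : X) : List (X × G) → X → ℕ → X
  | [], _, 0 => a
  | [], b, _ + 1 => b
  | _ :: _, _, 0 => a
  | e :: l, b, i + 1 => e.2 • wordPath e.1 l b i

theorem wordPath_zero (a : X) (l : List (X × G)) (b : X) : wordPath a l b 0 = a := by
  cases l <;> rfl

theorem wordPath_cons (a b : X) (e : X × G) (l : List (X × G)) (i : ℕ) :
    wordPath a (e :: l) b (i + 1) = e.2 • wordPath e.1 l b i := rfl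

@[simp] theorem wordProd_nil : wordProd ([] : List (X × G)) = 1 := rfl

@[simp] theorem wordProd_cons (e : X × G) (l : List (X × G)) :
    wordProd (e :: l) = e.2 * wordProd l := by simp [wordProd]

@[simp] theorem wordProd_append (l l' : List (X × G)) :
    wordProd (l ++ l') = wordProd l * wordProd l' := by simp [wordProd]

theorem wordProd_smulWord (g : G) (l : List (X × G)) :
    wordProd (smulWord g l) = g * wordProd l * g⁻¹ := by
  induction l with
  | nil => simp [smulWord]
  | cons e l ih =>
    rw [smulWord] at ih ⊢
    rw [List.map_cons, wordProd_cons, wordProd_cons, ih]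
    group

theorem wordPath_length (a : X) (l : List (X × G)) (b : X) :
    wordPath a l b (l.length + 1) = wordProd l • b := by
  induction l generalizing a with
  | nil => simp [wordPath]
  | cons e l ih => rw [List.length_cons, wordPath_cons, ih, wordProd_cons, mul_smul]

namespace IsReducedWord

variable {V : Set X} {l l' : List (X × G)} {e f : X × G}

theorem nil : IsReducedWord Γ V [] := ⟨by simp, by simp⟩

theorem of_cons (h : IsReducedWord Γ V (e :: l)) : IsReducedWord Γ V l :=
  ⟨fun f hf => h.mem f (List.mem_cons_of_mem _ hf), h.isChain.of_cons⟩

theorem of_append_left (h : IsReducedWord Γ V (l ++ l')) : IsReducedWord Γ V l :=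
  ⟨fun f hf => h.mem f (List.mem_append_left _ hf), h.isChain.left_of_append⟩

theorem cons (h : IsReducedWord Γ V l) (he : e.1 ∈ V ∧ e.2 ∈ Γ e.1 ∧ e.2 ≠ 1)
    (hl : ∀ f ∈ l.head?, e.1 ≠ f.1) : IsReducedWord Γ V (e :: l) := by
  refine ⟨?_, List.isChain_cons.2 ⟨hl, h.isChain⟩⟩
  rintro f hf
  rcases List.mem_cons.1 hf with rfl | hf
  exacts [he, h.mem f hf]

theorem append (h : IsReducedWord Γ V l) (h' : IsReducedWord Γ V l')
    (hl : ∀ e ∈ l.getLast?, ∀ f ∈ l'.head?, e.1 ≠ f.1) : IsReducedWord Γ V (l ++ l') := by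
  refine ⟨?_, List.isChain_append.2 ⟨h.isChain, h'.isChain, hl⟩⟩
  rintro f hf
  rcases List.mem_append.1 hf with hf | hf
  exacts [h.mem f hf, h'.mem f hf]

theorem smulWord (hC : IsRotationSystem σ C Γ) (hVC : V ⊆ C) (h : IsReducedWord Γ V l) {g : G}
    (hg : ∀ v ∈ V, g • v ∈ V) : IsReducedWord Γ V (smulWord g l) := by
  refine ⟨?_, ?_⟩
  · rintro f hf
    obtain ⟨e, he, rfl⟩ := List.mem_map.1 hf
    obtain ⟨h1, h2, h3⟩ := h.mem e he
    exact ⟨hg _ h1, hC.conj_mem g _ (hVC h1) _ h2, by simpa using h3⟩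
  · rw [_root_.smulWord, List.isChain_map]
    exact h.isChain.imp fun e f hef => by simpa using hef

end IsReducedWord

namespace IsFan

variable {A V : Set X} {l : List (X × G)} {a b : X}

theorem union_subset (hF : IsFan δ σ C Γ A V) : A ∪ V ⊆ C :=
  Set.union_subset hF.windmill.subset hF.subset

/-- Every product of rotations is a reduced word followed by an element of the windmill's group. -/
theorem exists_word (hC : IsRotationSystem σ C Γ) (hF : IsFan δ σ C Γ A V) {g : G}
    (hg : g ∈ rotationsOver Γ (A ∪ V)) :
    ∃ l, IsReducedWord Γ V l ∧ ∃ n ∈ rotationsOver Γ A, g = wordProd l * n := by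
  have key : ∀ w ∈ A ∪ V, ∀ x ∈ Γ w, ∀ y : G,
      (∃ l, IsReducedWord Γ V l ∧ ∃ n ∈ rotationsOver Γ A, y = wordProd l * n) →
      ∃ l, IsReducedWord Γ V l ∧ ∃ n ∈ rotationsOver Γ A, x * y = wordProd l * n := by
    rintro w hw x hx _ ⟨l, hl, n, hn, rfl⟩
    rcases hw with hw | hw
    -- A rotation of the windmill is pushed to the right through the word, which it conjugates; `V`
    -- is stable under it.
    · have hx' := mem_rotationsOver hw hx
      refine ⟨smulWord x l, hl.smulWord hC hF.subset (hF.smul_mem x hx'), x * n,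
        mul_mem hx' hn, ?_⟩
      rw [wordProd_smulWord]
      group
    · by_cases hx1 : x = 1
      · exact ⟨l, hl, n, hn, by rw [hx1, one_mul]⟩
      by_cases hd : ∀ f ∈ l.head?, w ≠ f.1
      · exact ⟨(w, x) :: l, hl.cons ⟨hw, hx, hx1⟩ hd, n, hn, by simp [mul_assoc]⟩
      push Not at hd
      obtain ⟨f, hf, rfl⟩ := hd
      obtain ⟨l, rfl⟩ : ∃ l', l = f :: l' := by
        cases l with
        | nil => simp at hf
        | cons f' l => simp at hf; exact ⟨l, by rw [hf]⟩
      by_cases hxf : x * f.2 = 1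
      · exact ⟨l, hl.of_cons, n, hn, by simp [← mul_assoc, hxf]⟩
      · refine ⟨(f.1, x * f.2) :: l, hl.of_cons.cons ⟨hw, mul_mem hx (hl.mem f (by simp)).2.1, hxf⟩
          (List.isChain_cons.1 hl.isChain).1, n, hn, by simp [mul_assoc]⟩
  induction hg using Subgroup.closure_induction_left with
  | one => exact ⟨[], .nil, 1, one_mem _, by simp⟩
  | mul_left x hx y hy ih => obtain ⟨w, hw, hx⟩ := hx; exact key w hw x hx y ih
  | inv_mul_cancel x hx y hy ih =>
    obtain ⟨w, hw, hx⟩ := hx; exact key w hw x⁻¹ (inv_mem hx) y ih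

theorem wordPath_one_mem (hC : IsRotationSystem σ C Γ) (hVC : V ⊆ C)
    (hl : IsReducedWord Γ V l) (hb : b ∈ A ∪ V) : wordPath a l b 1 ∈ A ∪ V := by
  cases l with
  | nil => exact hb
  | cons e l =>
    obtain ⟨hV, hΓ, -⟩ := hl.mem e (by simp)
    rw [wordPath_cons, wordPath_zero, hC.smul_apex _ (hVC hV) _ hΓ]
    exact Or.inr hV

/-- Each edge is a translate of a pair in `A ∪ V`, so that `IsFan.far` applies to it. -/
theorem exists_segment (hC : IsRotationSystem σ C Γ) (hVC : V ⊆ C) (l : List (X × G))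
    (hl : IsReducedWord Γ V l)
    (ha : a ∈ A ∪ V) (hb : b ∈ A ∪ V) : ∀ i < l.length + 1, ∃ f ∈ rotationsOver Γ (A ∪ V),
      ∃ p ∈ A ∪ V, ∃ q ∈ A ∪ V, wordPath a l b i = f • p ∧ wordPath a l b (i + 1) = f • q := by
  induction l generalizing a with
  | nil =>
    intro i hi
    obtain rfl : i = 0 := by simpa using hi
    exact ⟨1, one_mem _, a, ha, b, hb, by simp [wordPath], by simp [wordPath]⟩
  | cons e l ih =>
    obtain ⟨hV, hΓ, -⟩ := hl.mem e (by simp)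
    have he : e.2 ∈ rotationsOver Γ (A ∪ V) := mem_rotationsOver (Or.inr hV) hΓ
    intro i hi
    rcases i with _ | i
    · exact ⟨1, one_mem _, a, ha, _, wordPath_one_mem (a := a) hC hVC hl hb, by simp [wordPath_zero], by simp⟩
    · obtain ⟨f, hf, p, hp, q, hq, h1, h2⟩ := ih hl.of_cons (Or.inr hV) i
        (by simpa using hi)
      exact ⟨e.2 * f, mul_mem he hf, p, hp, q, hq, by rw [wordPath_cons, h1, mul_smul],
        by rw [wordPath_cons, h2, mul_smul]⟩

end IsFan

end RotationSystem

/-! ### The translates of a fan form a windmill -/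

section Fan

variable {G X : Type*} [Group G] [MetricSpace X] [MulAction G X] [IsIsometricSMul G X]
  {δ σ : ℝ} {C : Set X} {Γ : X → Subgroup G} {A V : Set X} {l : List (X × G)} {a b : X}

namespace IsFan

/-- Before rotation, both neighbours of a center lie in `A ∪ V` and have product at least `4δ`
there; the rotation lowers it to `2δ`. The start ranges over `A ∪ V` because the induction restarts
the path at the first center. -/
theorem isLocalGeodesic_wordPath (hC : IsRotationSystem σ C Γ) (hL : IsLengthSpace X)
    (hX : IsGromovHyperbolic δ X) (hδ : 0 < δ) (hσ : 100 * δ ≤ σ) (hF : IsFan δ σ C Γ A V)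
    (l : List (X × G)) (hl : IsReducedWord Γ V l) (ha : a ∈ A ∪ V) (hb : b ∈ A ∪ V)
    (hal : ∀ e ∈ l.head?, a ≠ e.1) (hbl : ∀ e ∈ l.getLast?, b ≠ e.1) (hab : l = [] → a ≠ b) :
    IsLocalGeodesic δ σ (wordPath a l b) (l.length + 1) := by
  induction l generalizing a with
  | nil =>
    refine ⟨fun i hi => ?_, fun i hi => absurd hi (by simp)⟩
    obtain rfl : i = 0 := by simpa using hi
    exact hC.apart a (hF.union_subset ha) b (hF.union_subset hb) (hab rfl)
  | cons e l ih =>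
    obtain ⟨hV, hΓ, h1⟩ := hl.mem e (by simp)
    have hfix := hC.smul_apex _ (hF.subset hV) _ hΓ
    have hae : a ≠ e.1 := hal e (by simp)
    have hlast : ∀ f ∈ l.getLast?, b ≠ f.1 := by
      intro f hf
      refine hbl f ?_
      cases l with
      | nil => simp at hf
      | cons f' l => rwa [List.getLast?_cons_cons]
    have hnil : l = [] → e.1 ≠ b := by
      rintro rfl
      exact (hbl e (by simp)).symm
    have IH := ih hl.of_cons (Or.inr hV) (List.isChain_cons.1 hl.isChain).1 hlast hnil
    refine ⟨fun i hi => ?_, fun i hi => ?_⟩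
    · rcases i with _ | i
      · rw [wordPath_cons, wordPath_zero, wordPath_zero, hfix]
        exact hC.apart a (hF.union_subset ha) e.1 (hF.subset hV) hae
      · rw [wordPath_cons, wordPath_cons, dist_smul]
        exact IH.le_dist i (by simpa using hi)
    · rcases i with _ | i
      · have hq : wordPath e.1 l b 1 ≠ e.1 := by
          have h2 := IH.le_dist 0 (by omega)
          rw [wordPath_zero] at h2
          intro h3
          rw [h3, dist_self] at h2
          linarith
        rw [wordPath_cons, wordPath_cons, wordPath_zero, wordPath_zero, hfix]
        exact hC.gromovProduct_smul_le hL hX hδ hσ (hF.subset hV) hΓ h1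
          (hF.angle _ hV _ ha _ (wordPath_one_mem hC hF.subset hl.of_cons hb) hae hq)
      · rw [wordPath_cons, wordPath_cons, wordPath_cons, gromovProduct_smul]
        exact IH.angle i (by simpa using hi)

theorem le_dist_wordProd_smul (hC : IsRotationSystem σ C Γ) (hL : IsLengthSpace X)
    (hX : IsGromovHyperbolic δ X) (hδ : 0 < δ) (hσ : 100 * δ ≤ σ) (hF : IsFan δ σ C Γ A V)
    (hl : IsReducedWord Γ V l) (hl0 : l ≠ []) (ha : a ∈ A) (hb : b ∈ A) :
    l.length * (σ - 6 * δ) ≤ dist a (wordProd l • b) := by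
  have hne : ∀ c ∈ A, ∀ e ∈ l, c ≠ e.1 := by
    rintro c hc e he rfl
    exact hF.notMem _ (hl.mem e he).1 hc
  have hp := hF.isLocalGeodesic_wordPath hC hL hX hδ hσ l hl (Or.inl ha) (Or.inl hb)
    (fun e he => hne a ha e (List.mem_of_mem_head? he))
    (fun e he => hne b hb e (List.mem_of_mem_getLast? he)) (fun h => absurd h hl0)
  have := hp.le_dist_zero hX hδ hσ _ le_rfl
  rw [wordPath_zero, wordPath_length] at this
  push_cast at this
  linarith

/-- The powers of a cyclically reduced word are reduced words. -/
theorem exists_word_pow (hC : IsRotationSystem σ C Γ) (hF : IsFan δ σ C Γ A V)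
    (hl : IsReducedWord Γ V l) (hl0 : l ≠ []) {n : G} (hn : n ∈ rotationsOver Γ A)
    (hcyc : ∀ e ∈ l.getLast?, ∀ f ∈ l.head?, e.1 ≠ n • f.1) (m : ℕ) :
    ∃ l', IsReducedWord Γ V l' ∧ l'.length = m * l.length ∧ (∀ f ∈ l'.head?, f ∈ l.head?) ∧
      (wordProd l * n) ^ m = wordProd l' * n ^ m := by
  induction m with
  | zero => exact ⟨[], .nil, by simp, by simp, by simp⟩
  | succ m ih =>
    obtain ⟨l', h1, h2, h3, h4⟩ := ih
    -- Moving `n` past the word for the `m`-th power conjugates that word. Its first letter is that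
    -- of `l`, so the junction is reduced by `hcyc`.
    refine ⟨l ++ smulWord n l',
      hl.append (h1.smulWord hC hF.subset (hF.smul_mem n hn)) ?_, ?_, ?_, ?_⟩
    · intro e he f hf
      rw [smulWord, List.head?_map] at hf
      obtain ⟨f', hf', rfl⟩ := Option.map_eq_some_iff.1 hf
      exact hcyc e he f' (h3 f' hf')
    · rw [List.length_append, smulWord, List.length_map, h2]
      ring
    · intro f hf
      rwa [List.head?_append_of_ne_nil _ hl0] at hf
    · rw [pow_succ', h4, wordProd_append, wordProd_smulWord, pow_succ']
      group

end IsFan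

theorem dist_pow_smul_le (g : G) (x : X) (m : ℕ) : dist (g ^ m • x) x ≤ m * dist (g • x) x := by
  induction m with
  | zero => simp
  | succ m ih =>
    have := dist_triangle (g ^ (m + 1) • x) (g ^ m • x) x
    rw [pow_succ, mul_smul, dist_smul] at this
    rw [pow_succ, mul_smul]
    push_cast
    linarith

/-- Changing the base point costs a bounded amount `2|x - a|`, negligible against `m` for large
powers. -/
theorem le_dist_smul_of_le_dist_pow_smul {g : G} {a : X} {c : ℝ}
    (h : ∀ m : ℕ, 0 < m → m * c ≤ dist a (g ^ m • a)) (x : X) : c ≤ dist (g • x) x := by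
  by_contra! hlt
  obtain ⟨m, hm⟩ := exists_nat_gt (2 * dist x a / (c - dist (g • x) x))
  rw [div_lt_iff₀ (by linarith)] at hm
  have hm0 : 0 < m := by
    rcases Nat.eq_zero_or_pos m with rfl | h0
    · have : 0 ≤ dist x a := dist_nonneg
      simp at hm
      linarith
    · exact h0
  have h1 := h m hm0
  have h2 := dist_pow_smul_le g x m
  have h3 := dist_triangle4 a x (g ^ m • x) (g ^ m • a)
  rw [dist_smul, dist_comm a x, dist_comm x (g ^ m • x)] at h3
  linarith

namespace IsFan

/-- A nontrivial rotation at another apex `w` would make `⟨v, v⟩_w = |v - w|` at most `2δ`. -/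
theorem mem_of_smul_eq (hC : IsRotationSystem σ C Γ) (hL : IsLengthSpace X)
    (hX : IsGromovHyperbolic δ X) (hδ : 0 < δ) (hσ : 100 * δ ≤ σ) {v : X} (hv : v ∈ C) {n : G}
    (hn : IsRotationOrFar δ σ C Γ n) (hnv : n • v = v) : n ∈ Γ v := by
  rcases hn with ⟨w, hw, hn⟩ | hn
  · by_cases hn1 : n = 1
    · rw [hn1]; exact one_mem _
    by_cases hvw : v = w
    · rwa [hvw]
    · have h1 := hC.apart v hv w hw hvw
      have h2 := hC.gromovProduct_smul_le hL hX hδ hσ (y := v) (z := v) hw hn hn1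
        (by rw [gromovProduct_self]; linarith)
      rw [hnv, gromovProduct_self] at h2
      linarith
  · have := hn v
    rw [hnv, dist_self] at this
    linarith

/-- Either powers of the element stay reduced, and the orbit of a point of `A` grows linearly, or
conjugation by the first letter lets it merge with the last one and shortens the word. For a single
letter, `n` fixes its apex and is absorbed in its rotation group. -/
theorem rotationOrFar_word (hC : IsRotationSystem σ C Γ) (hL : IsLengthSpace X)
    (hX : IsGromovHyperbolic δ X) (hδ : 0 < δ) (hσ : 100 * δ ≤ σ) (hF : IsFan δ σ C Γ A V)
    (k : ℕ) : ∀ l : List (X × G), l.length = k → IsReducedWord Γ V l →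
      ∀ n ∈ rotationsOver Γ A, IsRotationOrFar δ σ C Γ (wordProd l * n) := by
  induction k using Nat.strong_induction_on with
  | _ k ih =>
  intro l hk hl n hn
  by_cases hcyc : ∀ e ∈ l.getLast?, ∀ f ∈ l.head?, e.1 ≠ n • f.1
  · by_cases hl0 : l = []
    · rw [hl0, wordProd_nil, one_mul]
      exact hF.windmill.rotationOrFar n hn
    · obtain ⟨a, ha⟩ := hF.windmill.nonempty
      refine Or.inr (le_dist_smul_of_le_dist_pow_smul (a := a) fun m hm => ?_)
      obtain ⟨l', h1, h2, -, h4⟩ := hF.exists_word_pow hC hl hl0 hn hcyc m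
      have hlen : 0 < l.length := List.length_pos_iff.2 hl0
      have hl'0 : l' ≠ [] := by
        rw [← List.length_pos_iff, h2]; positivity
      have := hF.le_dist_wordProd_smul hC hL hX hδ hσ h1 hl'0 ha
        (hF.windmill.smul_mem _ (pow_mem hn m) a ha)
      rw [h4, mul_smul]
      refine le_trans ?_ this
      have hle : (m : ℝ) ≤ l'.length := by
        rw [h2]; exact_mod_cast Nat.le_mul_of_pos_right m hlen
      exact mul_le_mul_of_nonneg_right hle (by linarith)
  · push Not at hcyc
    obtain ⟨e, he, f, hf, hef⟩ := hcyc
    obtain ⟨l', rfl⟩ : ∃ l', l = f :: l' := by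
      cases l with
      | nil => simp at hf
      | cons f' l => simp at hf; exact ⟨l, by rw [hf]⟩
    obtain ⟨hfV, hfΓ, hf1⟩ := hl.mem f (by simp)
    rcases List.eq_nil_or_concat' l' with rfl | ⟨l'', e', rfl⟩
    · obtain rfl : f = e := by simpa using he
      have := mem_of_smul_eq hC hL hX hδ hσ (hF.subset hfV) (hF.windmill.rotationOrFar n hn)
        hef.symm
      refine Or.inl ⟨f.1, hF.subset hfV, ?_⟩
      simpa using mul_mem hfΓ this
    · obtain rfl : e' = e := by
        rw [← List.cons_append, List.getLast?_concat] at he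
        simpa using he
      obtain ⟨heV, heΓ, he1⟩ := hl.mem e' (by simp)
      have hr : e'.2 * (n * f.2 * n⁻¹) ∈ Γ e'.1 := by
        refine mul_mem heΓ ?_
        rw [hef]
        exact hC.conj_mem n _ (hF.subset hfV) _ hfΓ
      have hconj : wordProd (f :: (l'' ++ [e'])) * n =
          f.2 * (wordProd l'' * (e'.2 * (n * f.2 * n⁻¹)) * n) * f.2⁻¹ := by
        simp only [wordProd_cons, wordProd_append, wordProd_nil]
        group
      rw [hconj]
      refine IsRotationOrFar.conj hC ?_ _
      simp only [List.length_cons, List.length_append, List.length_nil] at hk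
      by_cases hr1 : e'.2 * (n * f.2 * n⁻¹) = 1
      · rw [hr1, mul_one]
        exact ih l''.length (by omega) l'' rfl hl.of_cons.of_append_left n hn
      · have hl2 : IsReducedWord Γ V (l'' ++ [(e'.1, e'.2 * (n * f.2 * n⁻¹))]) := by
          refine hl.of_cons.of_append_left.append
            (IsReducedWord.nil.cons ⟨heV, hr, hr1⟩ (by simp)) ?_
          have := (List.isChain_append.1 hl.of_cons.isChain).2.2
          simpa using this
        have := ih _ (by simp; omega) _ rfl hl2 n hn
        simpa using this

/-- The apices outside the union of the translates of a fan are far from its hull. -/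
theorem far_word (hC : IsRotationSystem σ C Γ) (hL : IsLengthSpace X)
    (hX : IsGromovHyperbolic δ X) (hδ : 0 < δ) (hσ : 100 * δ ≤ σ) (hF : IsFan δ σ C Γ A V)
    (k : ℕ) : ∀ l : List (X × G), l.length = k → IsReducedWord Γ V l →
      ∀ a ∈ A ∪ V, ∀ b ∈ A ∪ V, ∀ u ∈ C,
      (∀ f ∈ rotationsOver Γ (A ∪ V), ∀ c ∈ A ∪ V, f • c ≠ u) →
      8 * δ ≤ gromovProduct a (wordProd l • b) u := by
  induction k using Nat.strong_induction_on with
  | _ k ih =>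
  intro l hk hl a ha b hb u hu hout
  have htrans : ∀ f ∈ rotationsOver Γ (A ∪ V), f • u ∈ C ∧
      ∀ f' ∈ rotationsOver Γ (A ∪ V), ∀ c ∈ A ∪ V, f' • c ≠ f • u := by
    refine fun f hf => ⟨hC.smul_mem f u hu, fun f' hf' c hc h => ?_⟩
    refine hout (f⁻¹ * f') (mul_mem (inv_mem hf) hf') c hc ?_
    rw [mul_smul, h, inv_smul_smul]
  have hseg : ∀ f ∈ rotationsOver Γ (A ∪ V), ∀ p ∈ A ∪ V, ∀ q ∈ A ∪ V,
      10 * δ < gromovProduct (f • p) (f • q) u := by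
    intro f hf p hp q hq
    obtain ⟨h1, h2⟩ := htrans f⁻¹ (inv_mem hf)
    rw [gromovProduct_smul_base]
    exact hF.far _ h1 (fun h => h2 1 (one_mem _) _ h (one_smul _ _)) p hp q hq
  by_cases hl0 : l = []
  · have := hseg 1 (one_mem _) a ha b hb
    rw [one_smul, one_smul] at this
    rw [hl0, wordProd_nil, one_smul]
    linarith
  by_cases hal : ∀ e ∈ l.head?, a ≠ e.1
  · by_cases hbl : ∀ e ∈ l.getLast?, b ≠ e.1
    · by_contra! hlt
      have hp := hF.isLocalGeodesic_wordPath hC hL hX hδ hσ l hl ha hb hal hbl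
        (fun h => absurd h hl0)
      have hs := exists_segment hC hF.subset l hl ha hb
      -- With `t = 8δ`, some edge has product at most `10δ` at `u`, which `hseg` forbids; the
      -- vertices are apices other than `u`, hence at distance at least `σ > 23δ`.
      obtain ⟨i, hi, h⟩ := hp.exists_gromovProduct_le hX hδ hσ (Nat.succ_pos _) (u := u)
        (t := 8 * δ) (fun i hi => by
          obtain ⟨f, hf, p, hp, -, -, h1, -⟩ := hs i hi
          have := hC.apart u hu (f • p) (hC.smul_mem f p (hF.union_subset hp))
            (hout f hf p hp).symm
          rw [h1]
          linarith)
        (by rw [wordPath_zero, wordPath_length]; exact hlt.le)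
      obtain ⟨f, hf, p, hp, q, hq, h1, h2⟩ := hs i hi
      have := hseg f hf p hp q hq
      rw [h1, h2] at h
      linarith
    · push Not at hbl
      obtain ⟨e, he, rfl⟩ := hbl
      -- The last letter fixes `b` and can be dropped. When `a` is the first apex, the first letter
      -- is dropped likewise, after translating `u` by its inverse.
      rcases List.eq_nil_or_concat' l with rfl | ⟨l', e', rfl⟩
      · simp at he
      obtain rfl : e' = e := by simpa using he
      obtain ⟨heV, heΓ, he1⟩ := hl.mem e' (by simp)
      have := ih l'.length (by simp at hk; omega) l' rfl hl.of_append_left a ha e'.1 hb u hu hout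
      simpa [mul_smul, hC.smul_apex _ (hF.subset heV) _ heΓ] using this
  · push Not at hal
    obtain ⟨e, he, rfl⟩ := hal
    obtain ⟨l', rfl⟩ : ∃ l', l = e :: l' := by
      cases l with
      | nil => simp at he
      | cons f' l => simp at he; exact ⟨l, by rw [he]⟩
    obtain ⟨heV, heΓ, he1⟩ := hl.mem e (by simp)
    obtain ⟨h1, h2⟩ := htrans e.2⁻¹ (inv_mem (mem_rotationsOver ha heΓ))
    have := ih l'.length (by simp at hk; omega) l' rfl hl.of_cons e.1 ha b hb _ h1 h2
    rw [← gromovProduct_smul_base, hC.smul_apex _ (hF.subset heV) _ heΓ] at this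
    rwa [wordProd_cons, mul_smul]

/-- The union of the translates of a fan is a windmill. -/
theorem isWindmill (hC : IsRotationSystem σ C Γ) (hL : IsLengthSpace X)
    (hX : IsGromovHyperbolic δ X) (hδ : 0 < δ) (hσ : 100 * δ ≤ σ) (hF : IsFan δ σ C Γ A V) :
    IsWindmill δ σ C Γ {x | ∃ f ∈ rotationsOver Γ (A ∪ V), ∃ c ∈ A ∪ V, f • c = x} := by
  have hle : rotationsOver Γ {x | ∃ f ∈ rotationsOver Γ (A ∪ V), ∃ c ∈ A ∪ V, f • c = x} ≤
      rotationsOver Γ (A ∪ V) := by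
    refine (Subgroup.closure_le _).2 ?_
    rintro g ⟨_, ⟨f, hf, c, hc, rfl⟩, hg⟩
    have h1 := hC.conj_mem f⁻¹ _ (hC.smul_mem f c (hF.union_subset hc)) g hg
    rw [inv_smul_smul, inv_inv] at h1
    have h2 := mul_mem (mul_mem hf (mem_rotationsOver hc h1)) (inv_mem hf)
    have h3 : f * (f⁻¹ * g * f) * f⁻¹ = g := by group
    rwa [h3] at h2
  refine ⟨?_, ?_, ?_, ?_, ?_⟩
  · rintro _ ⟨f, -, c, hc, rfl⟩
    exact hC.smul_mem f c (hF.union_subset hc)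
  · obtain ⟨a, ha⟩ := hF.windmill.nonempty
    exact ⟨a, 1, one_mem _, a, Or.inl ha, one_smul _ _⟩
  · rintro g hg _ ⟨f, hf, c, hc, rfl⟩
    exact ⟨g * f, mul_mem (hle hg) hf, c, hc, mul_smul _ _ _⟩
  · rintro u hu hout _ ⟨f, hf, a, ha, rfl⟩ _ ⟨f', hf', b, hb, rfl⟩
    obtain ⟨l, hl, n, hn, hg⟩ := hF.exists_word hC (mul_mem (inv_mem hf) hf')
    have hnb : n • b ∈ A ∪ V := hb.imp (hF.windmill.smul_mem n hn b) (hF.smul_mem n hn b)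
    have h1 : f' • b = f • wordProd l • n • b := by
      rw [← mul_smul (wordProd l), ← hg, ← mul_smul, mul_inv_cancel_left]
    rw [h1, gromovProduct_smul_base]
    refine hF.far_word hC hL hX hδ hσ _ l rfl hl a ha _ hnb _ (hC.smul_mem _ _ hu) ?_
    intro f'' hf'' c hc h
    exact hout ⟨f * f'', mul_mem hf hf'', c, hc, by rw [mul_smul, h, smul_inv_smul]⟩
  · intro g hg
    obtain ⟨l, hl, n, hn, rfl⟩ := hF.exists_word hC (hle hg)
    exact hF.rotationOrFar_word hC hL hX hδ hσ _ l rfl hl n hn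

end IsFan

end Fan

/-! ### Growing windmills and Zorn's lemma -/

section Windmill

variable {G X : Type*} [Group G] [MetricSpace X] [MulAction G X]
  {δ σ : ℝ} {C : Set X} {Γ : X → Subgroup G} {A : Set X}

namespace IsWindmill

/-- The apices that are almost as close as possible to the hull of a windmill form a fan. -/
theorem exists_isFan [IsIsometricSMul G X] (hC : IsRotationSystem σ C Γ)
    (hX : IsGromovHyperbolic δ X) (hδ : 0 < δ) (hσ : 100 * δ ≤ σ) (hA : IsWindmill δ σ C Γ A) (hAC : ∃ v ∈ C, v ∉ A) :
    ∃ V : Set X, V.Nonempty ∧ IsFan δ σ C Γ A V := by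
  -- `F` is the infimum of the products over pairs in `A`, seen from outside apices. The margin `5δ`
  -- makes `V` nonempty and is the one needed for `IsFan.far`: `10δ + 3δ ≤ F + 5δ`.
  obtain ⟨F, hF8, hF, v₀, hv₀, hv₀A, a₀, ha₀, b₀, hb₀, hlt⟩ : ∃ F : ℝ, 8 * δ ≤ F ∧
      (∀ v ∈ C, v ∉ A → ∀ a ∈ A, ∀ b ∈ A, F ≤ gromovProduct a b v) ∧
      ∃ v ∈ C, v ∉ A ∧ ∃ a ∈ A, ∃ b ∈ A, gromovProduct a b v < F + 5 * δ := by
    set S : Set ℝ := {r | ∃ v ∈ C, v ∉ A ∧ ∃ a ∈ A, ∃ b ∈ A, gromovProduct a b v = r}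
    obtain ⟨v, hv, hvA⟩ := hAC
    obtain ⟨a, ha⟩ := hA.nonempty
    have hS : S.Nonempty := ⟨_, v, hv, hvA, a, ha, a, ha, rfl⟩
    have hlow : ∀ r ∈ S, 8 * δ ≤ r := by
      rintro _ ⟨v, hv, hvA, a, ha, b, hb, rfl⟩
      exact hA.far v hv hvA a ha b hb
    refine ⟨sInf S, le_csInf hS hlow, fun v hv hvA a ha b hb =>
      csInf_le ⟨_, hlow⟩ ⟨v, hv, hvA, a, ha, b, hb, rfl⟩, ?_⟩
    obtain ⟨_, ⟨v, hv, hvA, a, ha, b, hb, rfl⟩, hlt⟩ :=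
      exists_lt_of_csInf_lt hS (show sInf S < sInf S + 5 * δ by linarith)
    exact ⟨v, hv, hvA, a, ha, b, hb, hlt⟩
  set V : Set X := {v | v ∈ C ∧ v ∉ A ∧ ∃ a ∈ A, ∃ b ∈ A, gromovProduct a b v ≤ F + 5 * δ}
  have hBC : A ∪ V ⊆ C := Set.union_subset hA.subset fun v hv => hv.1
  have hwit : ∀ p ∈ A ∪ V, ∃ a ∈ A, ∃ b ∈ A, gromovProduct a b p ≤ F + 5 * δ := by
    rintro p (hp | hp)
    · exact ⟨p, hp, p, hp, by rw [gromovProduct_base]; linarith⟩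
    · exact hp.2.2
  have key : ∀ u ∈ C, u ∉ A → ∀ p ∈ A ∪ V, ∀ q ∈ A ∪ V, p ≠ u → q ≠ u → ∀ t ≤ 10 * δ,
      gromovProduct p q u ≤ t → ∃ a ∈ A, ∃ b ∈ A, gromovProduct a b u ≤ t + 3 * δ := by
    intro u hu huA p hp q hq hpu hqu t ht h
    obtain ⟨a, ha, b, hb, hab⟩ := hwit p hp
    obtain ⟨c, hc, d, hd, hcd⟩ := hwit q hq
    obtain ⟨e, he, f, hf, hef | hef⟩ := hX.exists_gromovProduct_le hδ ha hb hc hd hab hcd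
      (hC.apart p (hBC hp) u hu hpu) (hC.apart q (hBC hq) u hu hqu) h
    · exact ⟨e, he, f, hf, hef⟩
    -- The other alternative would give at most `(F + 5δ) - 100δ + 20δ + 5δ < F`.
    · have := hF u hu huA e he f hf
      linarith
  refine ⟨V, ⟨v₀, hv₀, hv₀A, a₀, ha₀, b₀, hb₀, hlt.le⟩, hA, fun v hv => hv.1, fun v hv => hv.2.1,
    ?_, ?_, ?_⟩
  · rintro n hn v ⟨hv, hvA, a, ha, b, hb, hab⟩
    refine ⟨hC.smul_mem n v hv, fun h => hvA ?_, n • a, hA.smul_mem n hn a ha, n • b,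
      hA.smul_mem n hn b hb, by rwa [gromovProduct_smul]⟩
    simpa using hA.smul_mem n⁻¹ (inv_mem hn) _ h
  · intro v hv p hp q hq hpv hqv
    by_contra! hlt
    -- A product below `4δ` would produce one of at most `7δ` for a pair in `A`, contradicting `8δ ≤
    -- F`.
    obtain ⟨a, ha, b, hb, hab⟩ := key v hv.1 hv.2.1 p hp q hq hpv hqv (4 * δ) (by linarith) hlt.le
    have := hF v hv.1 hv.2.1 a ha b hb
    linarith
  · intro u hu huB p hp q hq
    by_contra! hle
    have hne : ∀ p ∈ A ∪ V, p ≠ u := by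
      rintro p hp rfl
      exact huB hp
    have huA : u ∉ A := fun h => huB (Or.inl h)
    obtain ⟨a, ha, b, hb, hab⟩ := key u hu huA p hp q hq (hne p hp) (hne q hq) (10 * δ) le_rfl hle
    exact huB (Or.inr ⟨hu, huA, a, ha, b, hb, by linarith⟩)

theorem singleton (hC : IsRotationSystem σ C Γ) (hδ : 0 < δ) (hσ : 100 * δ ≤ σ) {v : X}
    (hv : v ∈ C) : IsWindmill δ σ C Γ {v} := by
  have hle : rotationsOver Γ {v} ≤ Γ v := by
    refine (Subgroup.closure_le _).2 ?_
    rintro g ⟨_, rfl, hg⟩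
    exact hg
  refine ⟨by simpa using hv, by simp, ?_, ?_, ?_⟩
  · rintro g hg _ rfl
    exact hC.smul_apex _ hv g (hle hg)
  · rintro u hu huv _ rfl _ rfl
    rw [gromovProduct_self]
    have := hC.apart _ hv u hu (fun h => huv h.symm)
    linarith
  · exact fun g hg => Or.inl ⟨v, hv, hle hg⟩

/-- Every condition involves one group element and finitely many points, hence is witnessed in one
member of the chain. -/
theorem sUnion {c : Set (Set X)} (hc : ∀ A ∈ c, IsWindmill δ σ C Γ A) (hchain : IsChain (· ⊆ ·) c)
    (hne : c.Nonempty) : IsWindmill δ σ C Γ (⋃₀ c) := by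
  have hdir : ∀ A ∈ c, ∀ B ∈ c, ∃ D ∈ c, A ⊆ D ∧ B ⊆ D := by
    intro A hA B hB
    rcases hchain.total hA hB with h | h
    exacts [⟨B, hB, h, subset_rfl⟩, ⟨A, hA, subset_rfl, h⟩]
  have hrot : ∀ g ∈ rotationsOver Γ (⋃₀ c), ∃ A ∈ c, g ∈ rotationsOver Γ A := by
    intro g hg
    induction hg using Subgroup.closure_induction with
    | mem g hg =>
      obtain ⟨v, ⟨A, hA, hv⟩, hg⟩ := hg
      exact ⟨A, hA, mem_rotationsOver hv hg⟩
    | one =>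
      obtain ⟨A, hA⟩ := hne
      exact ⟨A, hA, one_mem _⟩
    | mul x y _ _ hx hy =>
      obtain ⟨A, hA, hx⟩ := hx
      obtain ⟨B, hB, hy⟩ := hy
      obtain ⟨D, hD, hAD, hBD⟩ := hdir A hA B hB
      exact ⟨D, hD, mul_mem (rotationsOver_mono hAD hx) (rotationsOver_mono hBD hy)⟩
    | inv x _ hx =>
      obtain ⟨A, hA, hx⟩ := hx
      exact ⟨A, hA, inv_mem hx⟩
  refine ⟨Set.sUnion_subset fun A hA => (hc A hA).subset, ?_, ?_, ?_, ?_⟩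
  · obtain ⟨A, hA⟩ := hne
    obtain ⟨a, ha⟩ := (hc A hA).nonempty
    exact ⟨a, A, hA, ha⟩
  · rintro g hg a ⟨A, hA, ha⟩
    obtain ⟨B, hB, hg⟩ := hrot g hg
    obtain ⟨D, hD, hAD, hBD⟩ := hdir A hA B hB
    exact ⟨D, hD, (hc D hD).smul_mem g (rotationsOver_mono hBD hg) a (hAD ha)⟩
  · rintro v hv hvc a ⟨A, hA, ha⟩ b ⟨B, hB, hb⟩
    obtain ⟨D, hD, hAD, hBD⟩ := hdir A hA B hB
    exact (hc D hD).far v hv (fun h => hvc ⟨D, hD, h⟩) a (hAD ha) b (hBD hb)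
  · intro g hg
    obtain ⟨A, hA, hg⟩ := hrot g hg
    exact (hc A hA).rotationOrFar g hg

end IsWindmill

/-- The set of all apices is a windmill. -/
theorem IsRotationSystem.isWindmill [IsIsometricSMul G X] (hC : IsRotationSystem σ C Γ)
    (hL : IsLengthSpace X) (hX : IsGromovHyperbolic δ X) (hδ : 0 < δ) (hσ : 100 * δ ≤ σ)
    (hne : C.Nonempty) : IsWindmill δ σ C Γ C := by
  obtain ⟨v, hv⟩ := hne
  obtain ⟨A, -, hA⟩ := zorn_subset_nonempty {A | IsWindmill δ σ C Γ A}
    (fun c hc hchain hne => ⟨⋃₀ c, IsWindmill.sUnion hc hchain hne,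
      fun _ => Set.subset_sUnion_of_mem⟩) {v} (IsWindmill.singleton hC hδ hσ hv)
  have hAW : IsWindmill δ σ C Γ A := hA.prop
  by_cases hAC : ∃ v ∈ C, v ∉ A
  · obtain ⟨V, ⟨w, hw⟩, hF⟩ := hAW.exists_isFan hC hX hδ hσ hAC
    have hsub : A ∪ V ⊆ {x | ∃ f ∈ rotationsOver Γ (A ∪ V), ∃ c ∈ A ∪ V, f • c = x} :=
      fun c hc => ⟨1, one_mem _, c, hc, one_smul _ _⟩
    have := hA.le_of_ge (hF.isWindmill hC hL hX hδ hσ) (Set.subset_union_left.trans hsub)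
    exact absurd (this (hsub (Or.inr hw))) (hF.notMem w hw)
  · push Not at hAC
    rwa [hAW.subset.antisymm hAC] at hAW

end Windmill

/-! ### From pairs to apices with their rotation groups -/

section RotationFamily

variable {G X : Type*} [Group G] [MetricSpace X] [MulAction G X] {σ : ℝ}
  {R : Set (Subgroup G × X)}

/-- The apices of a collection of pairs `(H, v)`. -/
def apices (R : Set (Subgroup G × X)) : Set X := {v | ∃ H, (H, v) ∈ R}

/-- The rotation group of a given apex. -/
def rotationGroupAt (R : Set (Subgroup G × X)) (v : X) : Subgroup G := sSup {H | (H, v) ∈ R}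

/-- Two distinct pairs cannot share an apex, as `σ > 0`; the supremum is thus over a single
subgroup. -/
theorem IsRotationFamily.rotationGroupAt_eq (hR : IsRotationFamily σ R) (hσ : 0 < σ)
    {H : Subgroup G} {v : X} (h : (H, v) ∈ R) : rotationGroupAt R v = H := by
  have : {H | (H, v) ∈ R} = {H} := by
    refine Set.eq_singleton_iff_unique_mem.2 ⟨h, fun H' h' => ?_⟩
    by_contra hne
    have := hR.apices_apart H' H v v h' h (by simpa using hne)
    rw [dist_self] at this
    linarith
  rw [rotationGroupAt, this, sSup_singleton]

theorem IsRotationFamily.isRotationSystem (hR : IsRotationFamily σ R) (hσ : 0 < σ) :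
    IsRotationSystem σ (apices R) (rotationGroupAt R) := by
  refine ⟨?_, ?_, ?_, ?_, ?_⟩
  · rintro v ⟨H, hv⟩ h hh
    rw [hR.rotationGroupAt_eq hσ hv] at hh
    exact hR.le_stabilizer H v hv hh
  · rintro v ⟨H, hv⟩ x hx h hh h1
    rw [hR.rotationGroupAt_eq hσ hv] at hh
    exact hR.large_angle H v hv x (by rwa [Metric.mem_closedBall, dist_comm]) h hh h1
  · rintro v ⟨H, hv⟩ w ⟨H', hw⟩ hvw
    exact hR.apices_apart H H' v w hv hw fun h => hvw (Prod.ext_iff.1 h).2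
  · rintro g v ⟨H, hv⟩
    exact ⟨_, hR.smul_mem g H v hv⟩
  · rintro g v ⟨H, hv⟩ h hh
    rw [hR.rotationGroupAt_eq hσ hv] at hh
    rw [hR.rotationGroupAt_eq hσ (hR.smul_mem g H v hv)]
    exact ⟨h, hh, by simp⟩

theorem IsRotationFamily.rotationSubgroup_eq (hR : IsRotationFamily σ R) (hσ : 0 < σ) :
    rotationSubgroup R = rotationsOver (rotationGroupAt R) (apices R) := by
  rw [rotationSubgroup, rotationsOver]
  congr 1
  ext g
  constructor
  · rintro ⟨H, ⟨v, hv⟩, hg⟩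
    exact ⟨v, ⟨H, hv⟩, by rwa [hR.rotationGroupAt_eq hσ hv]⟩
  · rintro ⟨v, ⟨H, hv⟩, hg⟩
    exact ⟨H, ⟨v, hv⟩, by rwa [hR.rotationGroupAt_eq hσ hv] at hg⟩

theorem IsRotationFamily.normal_rotationSubgroup (hR : IsRotationFamily σ R) :
    (rotationSubgroup R).Normal := by
  refine ⟨fun n hn g => ?_⟩
  have hle : rotationSubgroup R ≤ (rotationSubgroup R).comap (MulAut.conj g).toMonoidHom := by
    refine (Subgroup.closure_le _).2 ?_
    rintro h ⟨H, ⟨v, hv⟩, hh⟩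
    exact Subgroup.subset_closure
      ⟨_, ⟨g • v, hR.smul_mem g H v hv⟩, Subgroup.mem_map_of_mem _ hh⟩
  simpa using hle hn

end RotationFamily

theorem mainTheorem1 (δ : ℝ) (hδ : 0 < δ) :
    ∃ σ₀ : ℝ, 0 < σ₀ ∧
      ∀ (X : Type u) [MetricSpace X] (G : Type v) [Group G] [MulAction G X]
        [IsIsometricSMul G X],
        IsLengthSpace X → IsGromovHyperbolic δ X →
        ∀ (σ : ℝ) (R : Set (Subgroup G × X)), σ₀ ≤ σ → R.Nonempty → IsRotationFamily σ R →
          (rotationSubgroup R).Normal ∧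
          ∀ g ∈ rotationSubgroup R, (∀ H ∈ rotationGroups R, g ∉ H) →
            ∀ x : X, σ - 166 * δ ≤ dist (g • x) x := by
  -- With this threshold the argument gives `σ - 6 * δ`, stronger than the required bound.
  refine ⟨100 * δ, by positivity, ?_⟩
  intro X _ G _ _ _ hL hX σ R hσ hne hR
  have hσ0 : 0 < σ := lt_of_lt_of_le (by positivity) hσ
  refine ⟨hR.normal_rotationSubgroup, fun g hg hgH x => ?_⟩
  obtain ⟨⟨H₀, v₀⟩, h₀⟩ := hne
  have hW := (hR.isRotationSystem hσ0).isWindmill hL hX hδ hσ ⟨v₀, H₀, h₀⟩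
  rw [hR.rotationSubgroup_eq hσ0] at hg
  rcases hW.rotationOrFar g hg with ⟨v, ⟨H, hv⟩, hg⟩ | hfar
  · rw [hR.rotationGroupAt_eq hσ0 hv] at hg
    exact absurd hg (hgH H ⟨v, hv⟩)
  · have := hfar x
    linarith
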